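/- Let $n\ge 1$. Write points of $\mathbb R^{4n}$ as $(x_i,y_i,z_i,w_i)_{1\le i\le n}$ and let $\rho=(\rho_1,\rho_2,\rho_3)$ be the $\mathbb R^3$-valued $2$-form on $\mathbb R^{4n}$ with $$\rho_1=\sum_i dx_i\wedge dy_i+dz_i\wedge dw_i,\quad \rho_2=\sum_i dx_i\wedge dz_i+dw_i\wedge dy_i,\quad \rho_3=\sum_i dx_i\wedge dw_i+dy_i\wedge dz_i .$$ Let $\mathbb H_{\mathbb H}^n=\mathbb R^{4n}\times\mathbb R^3$ be the quaternionic Heisenberg group, with product $(a,s)(b,t)=(a+b,\,s+t+\tfrac12\rho(a,b))$, projection $\pi(a,s)=a$, dilations $\delta_r(a,s)=(ra,r^2s)$ and, for $w\in\mathbb R^{4n}$, left-invariant horizontal vector field $X_w(a,s)=(w,\tfrac12\rho(a,w))$. Let $1\le p\le\infty$. Let $f:\mathbb R^{4n}\to\mathbb R^{4n}$ be continuous and of class $W^{1,p}_{loc}$, and suppose that $f$ admits a Sobolev contact lift $F:\mathbb H_{\mathbb H}^n\to\mathbb H_{\mathbb H}^n$. That is: $\pi\circ F=f\circ\pi$;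 the coordinates of $F$ and their weak derivatives along every $X_w$ belong to $L^p_{loc}$; and, for every $w$, the weak derivative $X_wF(g)$ is a horizontal vector at $F(g)$ for almost every $g$. Suppose that at almost every $g\in\mathbb H_{\mathbb H}^n$ (for instance, at every $g$) $F$ is Pansu differentiable with differential $D_PF(g)$ of full rank. That is, there is a bijective group homomorphism $L=D_PF(g)$ of $\mathbb H_{\mathbb H}^n$ that commutes with the dilations $\delta_r$, $r>0$, and satisfies $\delta_{1/r}\big(F(g)^{-1}F(g\,\delta_r h)\big)\to L(h)$ as $r\to0^+$, uniformly for $h$ in compact sets. Then $f$ is an affine transformation: there are an invertible linear map $A$ of $\mathbb R^{4n}$ and $b\in\mathbb R^{4n}$ with $f(x)=Ax+b$ for all $x$. Moreover there is an invertible linear map $\varphi$ of $\mathbb R^3$ with $\rho(Av,Aw)=\varphi(\rho(v,w))$ for all $v,w$; and for all $x,q\in\mathbb R^{4n}$ the map $Df(x)\,Df(q)^{-1}$ is orthogonal and preserves $\rho_1,\rho_2,\rho_3$. -/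

import Mathlib

open MeasureTheory Filter Topology
open scoped ENNReal ContDiff

noncomputable section

namespace QuatHeis

/-- `ℝ^{4n}`, with coordinates `x_i = v (i, 0)`, `y_i = v (i, 1)`, `z_i = v (i, 2)`,
`w_i = v (i, 3)`, `i = 1, …, n`, and the Euclidean norm. -/
abbrev Hor (n : ℕ) : Type := EuclideanSpace ℝ (Fin n × Fin 4)

/-- The centre `ℝ³` of the quaternionic Heisenberg group. -/
abbrev Ver : Type := EuclideanSpace ℝ (Fin 3)

variable {n : ℕ}

/-- The `ℝ³`-valued 2-form `ρ = (ρ₁, ρ₂, ρ₃)` on `ℝ^{4n}`, where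
`ρ₁ = ∑ dx_i ∧ dy_i + dz_i ∧ dw_i`, `ρ₂ = ∑ dx_i ∧ dz_i + dw_i ∧ dy_i`,
`ρ₃ = ∑ dx_i ∧ dw_i + dy_i ∧ dz_i`. -/
def rho (a b : Hor n) : Ver :=
  !₂[∑ i, ((a (i, 0) * b (i, 1) - a (i, 1) * b (i, 0))
        + (a (i, 2) * b (i, 3) - a (i, 3) * b (i, 2))),
     ∑ i, ((a (i, 0) * b (i, 2) - a (i, 2) * b (i, 0))
        + (a (i, 3) * b (i, 1) - a (i, 1) * b (i, 3))),
     ∑ i, ((a (i, 0) * b (i, 3) - a (i, 3) * b (i, 0))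
        + (a (i, 1) * b (i, 2) - a (i, 2) * b (i, 1)))]

theorem rho_add_left (a b c : Hor n) : rho (a + b) c = rho a c + rho b c := by
  ext k
  fin_cases k <;> simp [rho, ← Finset.sum_add_distrib] <;>
    exact Finset.sum_congr rfl fun i _ => by ring

theorem rho_add_right (a b c : Hor n) : rho a (b + c) = rho a b + rho a c := by
  ext k
  fin_cases k <;> simp [rho, ← Finset.sum_add_distrib] <;>
    exact Finset.sum_congr rfl fun i _ => by ring

theorem rho_zero_left (a : Hor n) : rho 0 a = 0 := by
  ext k
  fin_cases k <;> simp [rho]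

theorem rho_zero_right (a : Hor n) : rho a 0 = 0 := by
  ext k
  fin_cases k <;> simp [rho]

theorem rho_neg_self (a : Hor n) : rho (-a) a = 0 := by
  ext k
  fin_cases k <;> simp [rho] <;>
    exact Finset.sum_eq_zero fun i _ => by ring

/-- The quaternionic Heisenberg group in exponential coordinates: the simply connected Lie group
whose Lie algebra is the central extension `ℝ^{4n} ⊕ ℝ³` of the abelian Lie algebra `ℝ^{4n}` by
`ρ`, that is, `[(a, s), (b, t)] = (0, ρ(a, b))`. -/
def QHeis (n : ℕ) : Type := Hor n × Ver

/- Topology, smooth structure and Lebesgue (= Haar) measure are those of `ℝ^{4n} × ℝ³`.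
The additive structure is that of the Lie algebra, which exponential coordinates identify with the
group; the group law is the multiplicative one below. -/
instance : NormedAddCommGroup (QHeis n) := inferInstanceAs (NormedAddCommGroup (Hor n × Ver))
instance : NormedSpace ℝ (QHeis n) := inferInstanceAs (NormedSpace ℝ (Hor n × Ver))
instance : MeasureSpace (QHeis n) := inferInstanceAs (MeasureSpace (Hor n × Ver))
instance : BorelSpace (QHeis n) := inferInstanceAs (BorelSpace (Hor n × Ver))

/-- The point with exponential coordinates `(a, s)`. -/
def mk (a : Hor n) (s : Ver) : QHeis n := (a, s)

/-- The projection `π : G → ℝ^{4n}` of the central extension. -/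
def hor (g : QHeis n) : Hor n := g.1

/-- The central coordinate. -/
def ver (g : QHeis n) : Ver := g.2

/-- The group law given by the Baker-Campbell-Hausdorff formula:
`(a, s) (b, t) = (a + b, s + t + ρ(a, b) / 2)`. -/
instance : Group (QHeis n) where
  mul g h := mk (hor g + hor h) (ver g + ver h + (1 / 2 : ℝ) • rho (hor g) (hor h))
  one := mk 0 0
  inv g := mk (-hor g) (-ver g)
  mul_assoc g h k := by
    refine Prod.ext (add_assoc (hor g) (hor h) (hor k)) ?_
    change (ver g + ver h + (1 / 2 : ℝ) • rho (hor g) (hor h)) + ver k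
        + (1 / 2 : ℝ) • rho (hor g + hor h) (hor k)
      = ver g + (ver h + ver k + (1 / 2 : ℝ) • rho (hor h) (hor k))
        + (1 / 2 : ℝ) • rho (hor g) (hor h + hor k)
    rw [rho_add_left, rho_add_right, smul_add, smul_add]
    abel
  one_mul g := by
    refine Prod.ext (zero_add (hor g)) ?_
    change 0 + ver g + (1 / 2 : ℝ) • rho 0 (hor g) = ver g
    rw [rho_zero_left, smul_zero, add_zero, zero_add]
  mul_one g := by
    refine Prod.ext (add_zero (hor g)) ?_
    change ver g + 0 + (1 / 2 : ℝ) • rho (hor g) 0 = ver g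
    rw [rho_zero_right, smul_zero, add_zero, add_zero]
  inv_mul_cancel g := by
    refine Prod.ext (neg_add_cancel (hor g)) ?_
    change -ver g + ver g + (1 / 2 : ℝ) • rho (-hor g) (hor g) = 0
    rw [rho_neg_self, smul_zero, add_zero, neg_add_cancel]

/-- The dilations `δ_r (a, s) = (r a, r² s)`. -/
def dil (r : ℝ) (g : QHeis n) : QHeis n := mk (r • hor g) (r ^ 2 • ver g)

/-- The left-invariant horizontal vector field in the direction `w ∈ ℝ^{4n}`, whose value at
`g = (a, s)` is the velocity `(w, ρ(a, w) / 2)` at `t = 0` of the curve `t ↦ g (t w, 0)`. -/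
def leftField (w : Hor n) (g : QHeis n) : QHeis n := mk w ((1 / 2 : ℝ) • rho (hor g) w)

section Weak

variable {M W : Type*} [NormedAddCommGroup M] [NormedSpace ℝ M] [MeasureSpace M]
  [NormedAddCommGroup W] [NormedSpace ℝ W]

/-- `u` is locally `p`-integrable. -/
def MemLpLoc (p : ℝ≥0∞) (u : M → W) : Prop :=
  ∀ K : Set M, IsCompact K → MemLp u p (volume.restrict K)

/-- `v` is the weak (distributional) derivative of `u` along the vector field `X`:
`∫ (X φ) u = - ∫ φ v` for all test functions `φ ∈ C_c^∞`. This is the right notion for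
divergence-free fields; it is used only for constant fields and for left-invariant fields. -/
def HasWeakDerivAlong (X : M → M) (u v : M → W) : Prop :=
  ∀ φ : M → ℝ, ContDiff ℝ ∞ φ → HasCompactSupport φ →
    ∫ x, (fderiv ℝ φ x (X x)) • u x = -∫ x, φ x • v x

end Weak

/-- `f ∈ W^{1,p}_loc(ℝ^{4n}; ℝ^{4n})`. -/
def IsSobolev (p : ℝ≥0∞) (f : Hor n → Hor n) : Prop :=
  MemLpLoc p f ∧
    ∀ w : Hor n, ∃ v : Hor n → Hor n, MemLpLoc p v ∧ HasWeakDerivAlong (fun _ => w) f v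

/-- `F` is a contact map of class `W^{1,p}_loc` of the quaternionic Heisenberg group: the
coordinates of `F` are locally `p`-integrable together with their weak derivatives along the
left-invariant horizontal fields, and for each such field the weak derivative `(a, b)` of `F` is
almost everywhere a horizontal vector at `F g`, that is, `b = ρ(hor (F g), a) / 2`. -/
def IsSobolevContact (p : ℝ≥0∞) (F : QHeis n → QHeis n) : Prop :=
  MemLpLoc p (fun g => hor (F g)) ∧ MemLpLoc p (fun g => ver (F g)) ∧
    ∀ w : Hor n, ∃ (a : QHeis n → Hor n) (b : QHeis n → Ver),
      MemLpLoc p a ∧ MemLpLoc p b ∧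
      HasWeakDerivAlong (leftField w) (fun g => hor (F g)) a ∧
      HasWeakDerivAlong (leftField w) (fun g => ver (F g)) b ∧
      ∀ᵐ g : QHeis n, mk (a g) (b g) = leftField (a g) (F g)

/-- `F` is a lift of `f`: `π ∘ F = f ∘ π`. -/
def IsLift (F : QHeis n → QHeis n) (f : Hor n → Hor n) : Prop :=
  ∀ g, hor (F g) = f (hor g)

/-- `F` is Pansu differentiable at `g` with Pansu differential `L`: `L` is a group homomorphism
that commutes with dilations, and `δ_{1/r} (F(g)⁻¹ F(g δ_r h))` tends to `L h` as `r → 0+`,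
uniformly for `h` in compact sets. -/
def HasPansuDerivAt (F : QHeis n → QHeis n) (L : QHeis n →* QHeis n) (g : QHeis n) : Prop :=
  (∀ r : ℝ, 0 < r → ∀ h, L (dil r h) = dil r (L h)) ∧
    ∀ K : Set (QHeis n), IsCompact K →
      TendstoUniformlyOn (fun (r : ℝ) (h : QHeis n) => dil r⁻¹ ((F g)⁻¹ * F (g * dil r h)))
        (fun h => L h) (𝓝[>] 0) K

end QuatHeis

end

/-!
The vertical coordinate of `F` has weak horizontal derivatives that, by the contact condition,
depend only on `π g`, `f` and its derivative; hence those of the increment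
`F(g (0, s)) - F(g)` vanish. The horizontal fields generate the whole Lie algebra, so this
increment is almost everywhere a constant vector. Blowing it up shows that all Pansu differentials
of `F` act on the centre by one and the same linear map `φ`. At almost every point `f` is therefore
differentiable with a differential `A` such that `ρ(Av, Aw) = φ(ρ(v, w))`.

If `A₀` is one such differential, `A₀⁻¹A` preserves `ρ` and so commutes with the units `J₁, J₂, J₃`
that represent `ρ₁, ρ₂, ρ₃`. Thus the derivative of `f` intertwines `J_m` with
`P_m = A₀ J_m A₀⁻¹`, and the second derivative `S` of a mollification of `f`, being symmetric,
satisfies `P₁P₂ S(v, w) = S(J₁v, J₂w) = P₂P₁ S(v, w)`. As `P₁` and `P₂` are invertible and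
anticommute, `S = 0`, so the mollifications of `f` are affine, and hence so is `f`.
-/

noncomputable section

namespace QuatHeis

section LocalIntegrability

variable {E W : Type*} [NormedAddCommGroup E] [NormedSpace ℝ E] [FiniteDimensional ℝ E]
  [MeasureSpace E] [NormedAddCommGroup W] {u : E → W}

theorem MemLpLoc.locallyIntegrable [IsFiniteMeasureOnCompacts (volume : Measure E)] {p : ℝ≥0∞}
    (hp : 1 ≤ p) (hu : MemLpLoc p u) : LocallyIntegrable u := by
  have : ProperSpace E := FiniteDimensional.proper ℝ E
  refine locallyIntegrable_iff.2 fun K hK => ?_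
  have : IsFiniteMeasure ((volume : Measure E).restrict K) := ⟨by simpa using hK.measure_lt_top⟩
  exact (hu K hK).integrable hp

theorem locallyIntegrable_comp_add_right [BorelSpace E]
    [(volume : Measure E).IsAddHaarMeasure] (hu : LocallyIntegrable u) (c : E) :
    LocallyIntegrable fun x => u (x + c) := by
  have : ProperSpace E := FiniteDimensional.proper ℝ E
  refine locallyIntegrable_iff.2 fun K hK => ?_
  have hK' : IsCompact ((· + c) '' K) := hK.image (by fun_prop)
  have h := (measurePreserving_add_right volume c).restrict_preimage hK'.measurableSet
  exact (h.integrable_comp_of_integrable (hu.integrableOn_isCompact hK')).mono_measure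
    (Measure.restrict_mono (Set.subset_preimage_image _ _) le_rfl)

end LocalIntegrability

section WeakDerivatives

variable {E W : Type*} [NormedAddCommGroup E] [NormedSpace ℝ E] [MeasureSpace E]
  [NormedAddCommGroup W] [NormedSpace ℝ W] {X Y : E → E} {u u' v v' : E → W}

theorem HasWeakDerivAlong.congr_ae (h : HasWeakDerivAlong X u v) (hv : v =ᵐ[volume] v') :
    HasWeakDerivAlong X u v' := fun φ hφ hc =>
  (h φ hφ hc).trans <| congrArg Neg.neg <|
    integral_congr_ae (hv.mono fun x hx => congrArg (φ x • ·) hx)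

theorem HasWeakDerivAlong.smul_field {r : E → ℝ} (hr : ContDiff ℝ ∞ r)
    (hrX : ∀ x, fderiv ℝ r x (X x) = 0) (h : HasWeakDerivAlong X u v) :
    HasWeakDerivAlong (fun x => r x • X x) u (fun x => r x • v x) := fun φ hφ hc => by
  have h_mul : ∀ x, fderiv ℝ (fun y => r y * φ y) x (X x) = fderiv ℝ φ x (r x • X x) := fun x => by
    rw [fderiv_fun_mul (hr.differentiable (by simp) x) (hφ.differentiable (by simp) x)]
    simp [hrX]
  have h_rφ := h _ (hr.mul hφ) hc.mul_left
  simp only [h_mul] at h_rφ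
  rw [h_rφ]
  simp only [smul_smul, mul_comm]

variable [BorelSpace E]

theorem integrable_fderiv_smul {φ : E → ℝ} (hφ : ContDiff ℝ ∞ φ) (hc : HasCompactSupport φ)
    (hX : Continuous X) (hu : LocallyIntegrable u) :
    Integrable fun x => fderiv ℝ φ x (X x) • u x :=
  hu.integrable_smul_left_of_hasCompactSupport ((hφ.continuous_fderiv (by simp)).clm_apply hX)
    ((hc.fderiv (𝕜 := ℝ)).mono fun x hx h0 => hx (by simp [h0]))

theorem HasWeakDerivAlong.add_field (hX : Continuous X) (hY : Continuous Y)
    (hu : LocallyIntegrable u) (hv : LocallyIntegrable v) (hv' : LocallyIntegrable v')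
    (h : HasWeakDerivAlong X u v) (h' : HasWeakDerivAlong Y u v') :
    HasWeakDerivAlong (fun x => X x + Y x) u (fun x => v x + v' x) := fun φ hφ hc => by
  simp only [map_add, add_smul, smul_add]
  rw [integral_add (integrable_fderiv_smul hφ hc hX hu) (integrable_fderiv_smul hφ hc hY hu),
    integral_add (hv.integrable_smul_left_of_hasCompactSupport hφ.continuous hc)
      (hv'.integrable_smul_left_of_hasCompactSupport hφ.continuous hc),
    h φ hφ hc, h' φ hφ hc, neg_add]

theorem HasWeakDerivAlong.sum_field {ι : Type*} {s : Finset ι} {X : ι → E → E} {v : ι → E → W}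
    (hX : ∀ i, Continuous (X i)) (hu : LocallyIntegrable u) (hv : ∀ i, LocallyIntegrable (v i))
    (h : ∀ i, HasWeakDerivAlong (X i) u (v i)) :
    HasWeakDerivAlong (fun x => ∑ i ∈ s, X i x) u (fun x => ∑ i ∈ s, v i x) := fun φ hφ hc => by
  simp only [map_sum, Finset.sum_smul, Finset.smul_sum]
  rw [integral_finsetSum _ fun i _ => integrable_fderiv_smul hφ hc (hX i) hu,
    integral_finsetSum _ fun i _ =>
      (hv i).integrable_smul_left_of_hasCompactSupport hφ.continuous hc,
    ← Finset.sum_neg_distrib]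
  exact Finset.sum_congr rfl fun i _ => h i φ hφ hc

theorem HasWeakDerivAlong.sub (hX : Continuous X)
    (hu : LocallyIntegrable u) (hv : LocallyIntegrable v) (hu' : LocallyIntegrable u')
    (hv' : LocallyIntegrable v') (h : HasWeakDerivAlong X u v) (h' : HasWeakDerivAlong X u' v') :
    HasWeakDerivAlong X (fun x => u x - u' x) (fun x => v x - v' x) := fun φ hφ hc => by
  simp only [smul_sub]
  rw [integral_sub (integrable_fderiv_smul hφ hc hX hu) (integrable_fderiv_smul hφ hc hX hu'),
    integral_sub (hv.integrable_smul_left_of_hasCompactSupport hφ.continuous hc)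
      (hv'.integrable_smul_left_of_hasCompactSupport hφ.continuous hc),
    h φ hφ hc, h' φ hφ hc]
  abel

theorem HasWeakDerivAlong.ae_eq [FiniteDimensional ℝ E] [CompleteSpace W]
    (hv : LocallyIntegrable v) (hv' : LocallyIntegrable v') (h : HasWeakDerivAlong X u v)
    (h' : HasWeakDerivAlong X u v') :
    v =ᵐ[volume] v' :=
  ae_eq_of_integral_contDiff_smul_eq hv hv' fun φ hφ hc =>
    neg_injective ((h φ hφ hc).symm.trans (h' φ hφ hc))

variable [(volume : Measure E).IsAddHaarMeasure]

theorem HasWeakDerivAlong.comp_add_right (h : HasWeakDerivAlong X u v) {c : E}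
    (hX : ∀ x, X (x + c) = X x) :
    HasWeakDerivAlong X (fun x => u (x + c)) (fun x => v (x + c)) := fun φ hφ hc => by
  have h₁ := h (fun x => φ (x - c)) (hφ.comp (contDiff_id.sub contDiff_const))
    (hc.comp_homeomorph (Homeomorph.subRight c))
  rw [← integral_add_right_eq_self _ c,
    ← integral_add_right_eq_self (fun x => φ (x - c) • v x) c] at h₁
  simpa only [add_sub_cancel_right, fderiv_comp_sub, hX] using h₁

theorem hasWeakDerivAlong_of_hasLineDerivAt [FiniteDimensional ℝ E] {w : E}
    (hu : LocallyIntegrable u) (hv : LocallyIntegrable v) (h : ∀ x, HasLineDerivAt ℝ u (v x) x w) :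
    HasWeakDerivAlong (fun _ => w) u v := fun φ hφ hc => by
  have hφ' : ∀ x, HasLineDerivAt ℝ φ (fderiv ℝ φ x w) x w := fun x =>
    (hφ.differentiable (by simp) x).hasFDerivAt.hasLineDerivAt w
  have h_parts := integral_bilinear_hasLineDerivAt_right_eq_neg_left_of_integrable
    (μ := (volume : Measure E)) (B := ContinuousLinearMap.lsmul ℝ ℝ)
    (integrable_fderiv_smul hφ hc continuous_const hu)
    (hv.integrable_smul_left_of_hasCompactSupport hφ.continuous hc)
    (hu.integrable_smul_left_of_hasCompactSupport hφ.continuous hc)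
    (fun x _ => hφ' x) (fun x _ => h x)
  simpa only [ContinuousLinearMap.lsmul_apply, neg_neg] using (congrArg Neg.neg h_parts).symm

end WeakDerivatives

section Mollification

open Convolution ContinuousLinearMap

/-- A sequence of bump functions shrinking to the origin, all of them rescalings of the first. -/
def bump (E : Type*) [NormedAddCommGroup E] (k : ℕ) : ContDiffBump (0 : E) where
  rIn := 1 / ((k : ℝ) + 1)
  rOut := 2 * (1 / ((k : ℝ) + 1))
  rIn_pos := Nat.one_div_pos_of_nat
  rIn_lt_rOut := lt_two_mul_self Nat.one_div_pos_of_nat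

variable {E W : Type*} [NormedAddCommGroup E]

theorem tendsto_bump_rOut : Tendsto (fun k => (bump E k).rOut) atTop (𝓝 0) := by
  simpa [bump] using (tendsto_one_div_add_atTop_nhds_zero_nat (𝕜 := ℝ)).const_mul 2

variable [NormedSpace ℝ E]

theorem fderiv_comp_const_sub {φ : E → ℝ} (hφ : Differentiable ℝ φ) (x y : E) :
    fderiv ℝ (fun z => φ (x - z)) y = -fderiv ℝ φ (x - y) := by
  have h : fderiv ℝ (fun z => φ (x - z)) y = _ :=
    ((hφ (x - y)).hasFDerivAt.comp y ((hasFDerivAt_id y).const_sub x)).fderiv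
  simpa using h

variable [FiniteDimensional ℝ E]

theorem bump_apply (k : ℕ) (x : E) : bump E k x = bump E 0 (((k : ℝ) + 1) • x) := by
  have hk : (k : ℝ) + 1 ≠ 0 := by positivity
  simp [ContDiffBump.apply, bump, hk]

variable [MeasureSpace E] [BorelSpace E] [(volume : Measure E).IsAddHaarMeasure]
  [NormedAddCommGroup W] [NormedSpace ℝ W] {u v : E → W} {w : E}

theorem integral_norm_fderiv_bump_normed (k : ℕ) :
    ∫ x, ‖fderiv ℝ ((bump E k).normed volume) x‖ =
      ((k : ℝ) + 1) * ∫ x, ‖fderiv ℝ ((bump E 0).normed volume) x‖ := by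
  have hk : (0 : ℝ) < (k : ℝ) + 1 := by positivity
  have h_normed : ∀ j, (bump E j).normed volume = (∫ x, bump E j x)⁻¹ • ⇑(bump E j) := fun j => by
    ext x
    simp [ContDiffBump.normed_def, div_eq_inv_mul]
  have h_mass : ∫ x, bump E k x = (((k : ℝ) + 1) ^ Module.finrank ℝ E)⁻¹ * ∫ x, bump E 0 x := by
    simp_rw [bump_apply k]
    rw [Measure.integral_comp_smul, abs_of_pos (by positivity), smul_eq_mul]
  have h_fderiv : ∀ x, fderiv ℝ (bump E k) x = ((k : ℝ) + 1) • fderiv ℝ (bump E 0)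
      (((k : ℝ) + 1) • x) := fun x => by
    rw [← fderiv_comp_smul]
    exact congrArg (fderiv ℝ · x) (funext (bump_apply k))
  simp only [h_normed, fderiv_const_smul_field, Pi.smul_apply, norm_smul, integral_const_mul,
    h_fderiv, Real.norm_of_nonneg hk.le, h_mass]
  rw [Measure.integral_comp_smul volume (fun x => ‖fderiv ℝ (bump E 0) x‖),
    abs_of_pos (by positivity), smul_eq_mul]
  simp [abs_of_pos hk]
  field_simp

/-- The mollification of `u` by the `k`-th bump function. -/
def mollify (k : ℕ) (u : E → W) : E → W := (bump E k).normed volume ⋆[lsmul ℝ ℝ, volume] u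

theorem mollify_apply (k : ℕ) (u : E → W) (x : E) :
    mollify k u x = ∫ y, (bump E k).normed volume (x - y) • u y := by
  rw [mollify, convolution_eq_swap]
  rfl

theorem mollify_congr_ae (k : ℕ) (h : u =ᵐ[volume] v) : mollify k u = mollify k v := by
  ext x
  simp only [mollify_apply]
  exact integral_congr_ae (h.mono fun y hy => by simp only [hy])

theorem convolutionExists_bump (k : ℕ) (hu : LocallyIntegrable u) :
    ConvolutionExists ((bump E k).normed volume) u (lsmul ℝ ℝ) volume :=
  (bump E k).hasCompactSupport_normed.convolutionExists_left _ (bump E k).continuous_normed hu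

theorem contDiff_mollify (k : ℕ) (hu : LocallyIntegrable u) : ContDiff ℝ ∞ (mollify k u) :=
  (bump E k).hasCompactSupport_normed.contDiff_convolution_left _ (bump E k).contDiff_normed hu

theorem differentiable_mollify (k : ℕ) (hu : LocallyIntegrable u) :
    Differentiable ℝ (mollify k u) :=
  (contDiff_mollify k hu).differentiable (by simp)

theorem mollify_sub (k : ℕ) (hu : LocallyIntegrable u) (hv : LocallyIntegrable v) :
    mollify k (u - v) = mollify k u - mollify k v := by
  ext x
  simp only [mollify, convolution, Pi.sub_apply, map_sub]
  exact integral_sub (convolutionExists_bump k hu x) (convolutionExists_bump k hv x)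

theorem fderiv_mollify_apply (k : ℕ) (hu : LocallyIntegrable u) (x w : E) :
    fderiv ℝ (mollify k u) x w =
      ∫ y, fderiv ℝ ((bump E k).normed volume) (x - y) w • u y := by
  have hc := (bump E k).hasCompactSupport_normed (μ := volume)
  have hη : ContDiff ℝ ∞ ((bump E k).normed volume) := (bump E k).contDiff_normed
  have hex := (hc.fderiv (𝕜 := ℝ)).convolutionExists_left
    ((lsmul ℝ ℝ : ℝ →L[ℝ] W →L[ℝ] W).precompL E) (hη.continuous_fderiv (by simp)) hu x
  have h := (hc.hasFDerivAt_convolution_left (lsmul ℝ ℝ : ℝ →L[ℝ] W →L[ℝ] W)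
    (hη.of_le (by exact_mod_cast le_top)) hu x).fderiv
  rw [mollify, h, convolution, ContinuousLinearMap.integral_apply hex]
  simp only [precompL_apply, lsmul_apply]
  rw [← integral_sub_left_eq_self _ volume x]
  simp only [sub_sub_cancel]

theorem HasWeakDerivAlong.fderiv_mollify (h : HasWeakDerivAlong (fun _ => w) u v) (k : ℕ)
    (hu : LocallyIntegrable u) (x : E) : fderiv ℝ (mollify k u) x w = mollify k v x := by
  have hη : ContDiff ℝ ∞ ((bump E k).normed volume) := (bump E k).contDiff_normed
  have h_test := h (fun y => (bump E k).normed volume (x - y))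
    (hη.comp (contDiff_const.sub contDiff_id))
    ((bump E k).hasCompactSupport_normed.comp_homeomorph (Homeomorph.subLeft x))
  simp only [fderiv_comp_const_sub (hη.differentiable (by simp)), neg_apply, neg_smul,
    integral_neg, neg_inj] at h_test
  rw [fderiv_mollify_apply k hu, mollify_apply, h_test]

theorem ae_tendsto_mollify [CompleteSpace W] (hu : LocallyIntegrable u) :
    ∀ᵐ x, Tendsto (fun k => mollify k u x) atTop (𝓝 (u x)) :=
  ContDiffBump.ae_convolution_tendsto_right_of_locallyIntegrable (K := 2) tendsto_bump_rOut
    (Eventually.of_forall fun _ => le_rfl) hu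

variable [CompleteSpace W]

theorem mollify_const (k : ℕ) (c : W) (x : E) : mollify k (fun _ => c) x = c := by
  rw [mollify, convolution]
  simp only [lsmul_apply, integral_smul_const, (bump E k).integral_normed, one_smul]

theorem mollify_clm_comp {V : Type*} [NormedAddCommGroup V] [NormedSpace ℝ V] [CompleteSpace V]
    (k : ℕ) (hu : LocallyIntegrable u) (P : W →L[ℝ] V) (x : E) :
    mollify k (fun y => P (u y)) x = P (mollify k u x) := by
  rw [mollify, mollify, convolution, convolution,
    ← P.integral_comp_comm (convolutionExists_bump k hu x)]
  simp only [lsmul_apply, map_smul]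

end Mollification

section WeakVersusPointwise

variable {E W : Type*} [NormedAddCommGroup E] [NormedSpace ℝ E] [FiniteDimensional ℝ E]
  [MeasureSpace E] [BorelSpace E] [(volume : Measure E).IsAddHaarMeasure]
  [NormedAddCommGroup W] [NormedSpace ℝ W] {u v : E → W} {x w : E}

theorem hasWeakDerivAlong_affine (A : E →L[ℝ] W) (c : W) (x w : E) :
    HasWeakDerivAlong (fun _ => w) (fun y => c + A (y - x)) (fun _ => A w) := by
  have : ProperSpace E := FiniteDimensional.proper ℝ E
  refine hasWeakDerivAlong_of_hasLineDerivAt (by fun_prop : Continuous _).locallyIntegrable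
    continuous_const.locallyIntegrable fun y => HasFDerivAt.hasLineDerivAt ?_ w
  exact (A.hasFDerivAt.comp y ((hasFDerivAt_id y).sub_const x)).const_add c

theorem norm_fderiv_mollify_le {δ : ℝ} (k : ℕ) (hu : LocallyIntegrable u)
    (h : ∀ y ∈ Metric.closedBall x (bump E k).rOut, ‖u y‖ ≤ δ) (w : E) :
    ‖fderiv ℝ (mollify k u) x w‖ ≤
      ((k : ℝ) + 1) * (∫ z, ‖fderiv ℝ ((bump E 0).normed volume) z‖) * (‖w‖ * δ) := by
  set η := (bump E k).normed (volume : Measure E) with hη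
  have hDη : Integrable fun z => ‖fderiv ℝ η z‖ :=
    (((bump E k).contDiff_normed (n := 1)).continuous_fderiv
      (by simp)).norm.integrable_of_hasCompactSupport
      ((bump E k).hasCompactSupport_normed.fderiv (𝕜 := ℝ)).norm
  have h_bound : ∀ y, ‖fderiv ℝ η (x - y) w • u y‖ ≤ ‖fderiv ℝ η (x - y)‖ * (‖w‖ * δ) :=
    fun y => by
      by_cases hy : x - y ∈ tsupport η
      · rw [hη, (bump E k).tsupport_normed_eq, mem_closedBall_zero_iff, norm_sub_rev] at hy
        rw [norm_smul, ← mul_assoc]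
        gcongr
        · exact (fderiv ℝ η (x - y)).le_opNorm w
        · exact h y (mem_closedBall_iff_norm.2 hy)
      · rw [fderiv_of_notMem_tsupport ℝ hy]
        simp
  rw [fderiv_mollify_apply k hu, ← integral_norm_fderiv_bump_normed,
    ← integral_sub_left_eq_self (fun z => ‖fderiv ℝ ((bump E k).normed volume) z‖) volume x,
    ← integral_mul_const]
  exact norm_integral_le_of_norm_le ((hDη.comp_sub_left x).mul_const _) (ae_of_all _ h_bound)

variable [CompleteSpace W]

theorem tendsto_fderiv_mollify (hu : LocallyIntegrable u) {A : E →L[ℝ] W}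
    (hA : HasFDerivAt u A x) (w : E) :
    Tendsto (fun k => fderiv ℝ (mollify k u) x w) atTop (𝓝 (A w)) := by
  have : ProperSpace E := FiniteDimensional.proper ℝ E
  set a : E → W := fun y => u x + A (y - x)
  have ha : LocallyIntegrable a := (by fun_prop : Continuous a).locallyIntegrable
  have h_sub : ∀ k, fderiv ℝ (mollify k (u - a)) x w = fderiv ℝ (mollify k u) x w - A w :=
    fun k => by
      rw [mollify_sub k hu ha, fderiv_sub (differentiable_mollify k hu x)
        (differentiable_mollify k ha x), sub_apply,
        (hasWeakDerivAlong_affine A (u x) x w).fderiv_mollify k ha, mollify_const]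
  set C := ∫ z, ‖fderiv ℝ ((bump E 0).normed volume) z‖
  have : 0 ≤ C := integral_nonneg fun z => norm_nonneg _
  refine tendsto_sub_nhds_zero_iff.1 <| Asymptotics.IsLittleO.tendsto_zero_of_tendsto
    (v := fun _ : ℕ => 2 * C * ‖w‖) (Asymptotics.isLittleO_iff.2 fun ε hε => ?_)
    tendsto_const_nhds
  obtain ⟨δ, hδ, hball⟩ := Metric.eventually_nhds_iff_ball.1 (hA.isLittleO.def hε)
  filter_upwards [(tendsto_bump_rOut (E := E)).eventually_lt_const hδ] with k hk
  have h_small : ∀ y ∈ Metric.closedBall x (bump E k).rOut,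
      ‖(u - a) y‖ ≤ ε * (bump E k).rOut := fun y hy => by
    rw [Pi.sub_apply, ← sub_sub]
    refine (hball y (Metric.closedBall_subset_ball hk hy)).trans ?_
    gcongr
    exact mem_closedBall_iff_norm.1 hy
  rw [← h_sub, Real.norm_of_nonneg (by positivity)]
  refine (norm_fderiv_mollify_le k (hu.sub ha) h_small w).trans_eq ?_
  have h_rOut : (bump E k).rOut = 2 * (1 / ((k : ℝ) + 1)) := rfl
  rw [h_rOut]
  field_simp
  exact mul_comm C ‖w‖

theorem HasWeakDerivAlong.ae_eq_of_hasFDerivAt (hu : LocallyIntegrable u)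
    (hv : LocallyIntegrable v) (h : HasWeakDerivAlong (fun _ => w) u v) :
    ∀ᵐ x, ∀ A : E →L[ℝ] W, HasFDerivAt u A x → v x = A w := by
  filter_upwards [ae_tendsto_mollify hv] with x hx A hA
  refine tendsto_nhds_unique hx ((tendsto_fderiv_mollify hu hA w).congr fun k => ?_)
  exact h.fderiv_mollify k hu x

theorem ae_eq_const_of_mollify (hu : LocallyIntegrable u)
    (h : ∀ k x, mollify k u x = mollify k u 0) : ∃ c, u =ᵐ[volume] fun _ => c := by
  obtain ⟨x₀, hx₀⟩ := (ae_tendsto_mollify hu).exists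
  refine ⟨u x₀, ?_⟩
  filter_upwards [ae_tendsto_mollify hu] with x hx
  exact tendsto_nhds_unique (hx.congr (h · x)) (hx₀.congr (h · x₀))

theorem ae_eq_const_of_hasWeakDerivAlong_zero (hu : LocallyIntegrable u)
    (h : ∀ w : E, HasWeakDerivAlong (fun _ => w) u (fun _ => 0)) :
    ∃ c, u =ᵐ[volume] fun _ => c := by
  refine ae_eq_const_of_mollify hu fun k x =>
    is_const_of_fderiv_eq_zero (𝕜 := ℝ) (differentiable_mollify k hu) (fun y => ?_) x 0
  ext w
  rw [(h w).fderiv_mollify k hu, mollify_const, zero_apply]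

end WeakVersusPointwise

section Intertwining

variable {E W : Type*} [NormedAddCommGroup E] [NormedSpace ℝ E] [NormedAddCommGroup W]
  [NormedSpace ℝ W] {K₁ K₂ : E → E} {P₁ P₂ : W →L[ℝ] W}

theorem fderiv_fderiv_apply_of_intertwining {g : E → W} {K : E → E} {P : W →L[ℝ] W} {y : E}
    (hg : DifferentiableAt ℝ (fderiv ℝ g) y)
    (hK : ∀ x w, fderiv ℝ g x (K w) = P (fderiv ℝ g x w)) (u w : E) :
    fderiv ℝ (fderiv ℝ g) y u (K w) = P (fderiv ℝ (fderiv ℝ g) y u w) := by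
  have h_apply : ∀ w, HasFDerivAt (fun z => fderiv ℝ g z w)
      ((ContinuousLinearMap.apply ℝ W w).comp (fderiv ℝ (fderiv ℝ g) y)) y := fun w =>
    (ContinuousLinearMap.apply ℝ W w).hasFDerivAt.comp y hg.hasFDerivAt
  have h := h_apply (K w)
  simp only [hK] at h
  exact DFunLike.congr_fun (h.unique (P.hasFDerivAt.comp y (h_apply w))) u

theorem fderiv_eq_of_intertwining {g : E → W} (hg : ContDiff ℝ ∞ g)
    (hP : ∀ y, P₁ (P₂ y) = P₂ (P₁ y) → y = 0)
    (hK₁ : ∀ x w, fderiv ℝ g x (K₁ w) = P₁ (fderiv ℝ g x w))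
    (hK₂ : ∀ x w, fderiv ℝ g x (K₂ w) = P₂ (fderiv ℝ g x w)) (x : E) :
    fderiv ℝ g x = fderiv ℝ g 0 := by
  have hd : Differentiable ℝ (fderiv ℝ g) :=
    (hg.fderiv_right (m := ∞) (by simp)).differentiable (by simp)
  refine is_const_of_fderiv_eq_zero (𝕜 := ℝ) hd (fun y => ?_) x 0
  set D := fderiv ℝ (fderiv ℝ g) y
  have h_symm : ∀ u w, D u w = D w u := second_derivative_symmetric
    (fun z => (hg.differentiable (by simp) z).hasFDerivAt) (hd y).hasFDerivAt
  have h₁ : ∀ u w, D u (K₁ w) = P₁ (D u w) := fderiv_fderiv_apply_of_intertwining (hd y) hK₁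
  have h₂ : ∀ u w, D u (K₂ w) = P₂ (D u w) := fderiv_fderiv_apply_of_intertwining (hd y) hK₂
  ext u w
  refine hP _ ?_
  calc P₁ (P₂ (D u w)) = P₁ (D u (K₂ w)) := by rw [h₂]
    _ = D (K₂ w) (K₁ u) := by rw [h_symm u, ← h₁]
    _ = P₂ (D (K₁ u) w) := by rw [h_symm, h₂]
    _ = P₂ (P₁ (D u w)) := by rw [h_symm, h₁, h_symm]

variable [FiniteDimensional ℝ E] [MeasureSpace E] [BorelSpace E]
  [(volume : Measure E).IsAddHaarMeasure] [CompleteSpace W] {u : E → W} {v : E → E → W}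

theorem mollify_intertwining {K : E → E} {P : W →L[ℝ] W} (hu : LocallyIntegrable u)
    (hv : ∀ w, LocallyIntegrable (v w)) (huv : ∀ w, HasWeakDerivAlong (fun _ => w) u (v w))
    (hK : ∀ w, v (K w) =ᵐ[volume] fun x => P (v w x)) (k : ℕ) (x w : E) :
    fderiv ℝ (mollify k u) x (K w) = P (fderiv ℝ (mollify k u) x w) := by
  rw [(huv _).fderiv_mollify k hu, (huv _).fderiv_mollify k hu, mollify_congr_ae k (hK w),
    mollify_clm_comp k (hv w)]

theorem exists_ae_eq_affine_of_intertwining (hu : LocallyIntegrable u)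
    (hv : ∀ w, LocallyIntegrable (v w)) (huv : ∀ w, HasWeakDerivAlong (fun _ => w) u (v w))
    (hP : ∀ y, P₁ (P₂ y) = P₂ (P₁ y) → y = 0)
    (hK₁ : ∀ w, v (K₁ w) =ᵐ[volume] fun x => P₁ (v w x))
    (hK₂ : ∀ w, v (K₂ w) =ᵐ[volume] fun x => P₂ (v w x)) :
    ∃ (T : E →L[ℝ] W) (b : W), u =ᵐ[volume] fun x => T x + b := by
  have : ProperSpace E := FiniteDimensional.proper ℝ E
  have hv_const : ∀ w, ∃ c, v w =ᵐ[volume] fun _ => c := fun w =>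
    ae_eq_const_of_mollify (hv w) fun k x => by
      rw [← (huv w).fderiv_mollify k hu, ← (huv w).fderiv_mollify k hu,
        fderiv_eq_of_intertwining (contDiff_mollify k hu) hP
          (mollify_intertwining hu hv huv hK₁ k) (mollify_intertwining hu hv huv hK₂ k)]
  set T := fderiv ℝ (mollify 0 u) 0
  have hT : LocallyIntegrable T := T.continuous.locallyIntegrable
  have hvT : ∀ w, v w =ᵐ[volume] fun _ => T w := fun w => by
    obtain ⟨c, hc⟩ := hv_const w
    rwa [(huv w).fderiv_mollify 0 hu, mollify_congr_ae 0 hc, mollify_const]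
  obtain ⟨b, hb⟩ := ae_eq_const_of_hasWeakDerivAlong_zero (hu.sub hT) fun w => by
    have hTw : HasWeakDerivAlong (fun _ => w) T fun _ => T w := by
      simpa using hasWeakDerivAlong_affine T 0 0 w
    refine ((huv w).sub continuous_const hu (hv w) hT continuous_const.locallyIntegrable
      hTw).congr_ae ?_
    exact (hvT w).mono fun x hx => sub_eq_zero.2 hx
  exact ⟨T, b, hb.mono fun x hx => (eq_add_of_sub_eq' hx)⟩

end Intertwining

section QuaternionicForm

open scoped RealInnerProductSpace

variable {n : ℕ}

/-- Left multiplication by the `m`-th imaginary quaternion unit on each block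
`(x_i, y_i, z_i, w_i)`, read as `x_i + y_i i + z_i j + w_i k`. The form `ρ_m` is the Kähler form
of this complex structure. -/
def quatUnit (m : Fin 3) : Hor n →ₗ[ℝ] Hor n where
  toFun a := WithLp.toLp 2 fun q =>
    ![![-a (q.1, 1), a (q.1, 0), -a (q.1, 3), a (q.1, 2)],
      ![-a (q.1, 2), a (q.1, 3), a (q.1, 0), -a (q.1, 1)],
      ![-a (q.1, 3), -a (q.1, 2), a (q.1, 1), a (q.1, 0)]] m q.2
  map_add' a b := by
    ext ⟨i, k⟩
    fin_cases m <;> fin_cases k <;> simp <;> ring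
  map_smul' r a := by
    ext ⟨i, k⟩
    fin_cases m <;> fin_cases k <;> simp

theorem quatUnit_quatUnit (m : Fin 3) (a : Hor n) : quatUnit m (quatUnit m a) = -a := by
  ext ⟨i, k⟩
  fin_cases m <;> fin_cases k <;> simp [quatUnit]

theorem quatUnit_succ (m : Fin 3) (a : Hor n) :
    quatUnit m (quatUnit (m + 1) a) = quatUnit (m + 2) a := by
  ext ⟨i, k⟩
  fin_cases m <;> fin_cases k <;> simp [quatUnit]

theorem quatUnit_succ_swap (m : Fin 3) (a : Hor n) :
    quatUnit (m + 1) (quatUnit m a) = -quatUnit (m + 2) a := by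
  ext ⟨i, k⟩
  fin_cases m <;> fin_cases k <;> simp [quatUnit]

theorem quatUnit_eq_zero_iff {m : Fin 3} {a : Hor n} : quatUnit m a = 0 ↔ a = 0 := by
  refine ⟨fun h => ?_, fun h => by rw [h, map_zero]⟩
  rw [← neg_eq_zero, ← quatUnit_quatUnit m, h, map_zero]

theorem eq_zero_of_quatUnit_comm {m : Fin 3} {a : Hor n}
    (h : quatUnit m (quatUnit (m + 1) a) = quatUnit (m + 1) (quatUnit m a)) : a = 0 := by
  rw [quatUnit_succ, quatUnit_succ_swap] at h
  have : IsAddTorsionFree (Hor n) := .of_isTorsionFree ℝ _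
  exact quatUnit_eq_zero_iff.1 (self_eq_neg.1 h)

theorem rho_apply (a b : Hor n) (m : Fin 3) : rho a b m = ⟪quatUnit m a, b⟫ := by
  rw [PiLp.inner_apply, Fintype.sum_prod_type]
  fin_cases m <;> simp only [rho, Fin.zero_eta, Fin.mk_one, Fin.reduceFinMk, PiLp.toLp_apply,
    Matrix.cons_val] <;> refine Finset.sum_congr rfl fun i _ => ?_ <;>
    simp [quatUnit, Fin.sum_univ_four] <;> ring

theorem rho_smul_left (r : ℝ) (a b : Hor n) : rho (r • a) b = r • rho a b := by
  ext m
  simp [rho_apply, real_inner_smul_left]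

theorem rho_self (a : Hor n) : rho a a = 0 := by
  have h := rho_add_left a (-a) a
  rwa [add_neg_cancel, rho_zero_left, rho_neg_self, add_zero, eq_comm] at h

theorem rho_swap (a b : Hor n) : rho b a = -rho a b := by
  have h := rho_self (a + b)
  rw [rho_add_left, rho_add_right, rho_add_right, rho_self, rho_self, zero_add, add_zero] at h
  exact (neg_eq_of_add_eq_zero_right h).symm

theorem rho_quatUnit_succ (m : Fin 3) (a b : Hor n) :
    rho (quatUnit (m + 1) a) b m = rho a b (m + 2) := by
  rw [rho_apply, rho_apply, quatUnit_succ]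

theorem eq_zero_of_rho_eq_zero {m : Fin 3} {a : Hor n} (h : ∀ b, rho a b m = 0) : a = 0 :=
  quatUnit_eq_zero_iff.1 <| inner_self_eq_zero.1 <|
    (rho_apply a (quatUnit m a) m).symm.trans (h _)

theorem exists_rho_eq [NeZero n] (c : Ver) : ∃ v w : Hor n, rho v w = c := by
  refine ⟨WithLp.toLp 2 fun q => if q.1 = 0 then ![1, 0, 0, 0] q.2 else 0,
    WithLp.toLp 2 fun q => if q.1 = 0 then ![0, c 0, c 1, c 2] q.2 else 0, ?_⟩
  ext k
  fin_cases k <;> simp [rho]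

theorem map_quatUnit_of_rho_eq {B : Hor n → Hor n} (hB : Function.Surjective B)
    (hρ : ∀ v w, rho (B v) (B w) = rho v w) (m : Fin 3) (v : Hor n) :
    B (quatUnit m v) = quatUnit m (B v) := by
  obtain ⟨m, rfl⟩ : ∃ j : Fin 3, m = j + 1 := ⟨m - 1, by simp⟩
  refine sub_eq_zero.1 <| eq_zero_of_rho_eq_zero (m := m) fun b => ?_
  obtain ⟨w, rfl⟩ := hB b
  rw [rho_apply, map_sub, inner_sub_left, ← rho_apply, ← rho_apply, hρ, rho_quatUnit_succ,
    rho_quatUnit_succ, hρ, sub_self]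

end QuaternionicForm

section GradedHomomorphisms

variable {n : ℕ}

theorem mk_hor_ver (g : QHeis n) : mk (hor g) (ver g) = g := rfl

theorem mk_mul_mk (a b : Hor n) (s t : Ver) :
    mk a s * mk b t = mk (a + b) (s + t + (1 / 2 : ℝ) • rho a b) := rfl

theorem mk_zero_mul_mk_zero (a : Hor n) (s : Ver) : mk a 0 * mk 0 s = mk a s := by
  rw [mk_mul_mk, rho_zero_right, add_zero, zero_add, smul_zero, add_zero]

theorem dil_mk (r : ℝ) (a : Hor n) (s : Ver) : dil r (mk a s) = mk (r • a) (r ^ 2 • s) := rfl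

theorem dil_two_mk_zero (a : Hor n) : dil 2 (mk a 0) = mk a 0 * mk a 0 := by
  rw [mk_mul_mk, dil_mk, rho_self, two_smul, smul_zero, smul_zero, add_zero, add_zero]

theorem dil_sqrt_zero_mk {r : ℝ} (hr : 0 ≤ r) (s : Ver) :
    dil √r (mk (0 : Hor n) s) = mk 0 (r • s) := by
  rw [dil_mk, smul_zero, Real.sq_sqrt hr]

theorem zero_mk_mul_zero_mk (s t : Ver) : mk (0 : Hor n) s * mk 0 t = mk 0 (s + t) := by
  rw [mk_mul_mk, rho_self, smul_zero, add_zero, add_zero]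

/-- An additive map commuting with positive homotheties, as a linear map. -/
def linearOfPosHomogeneous {V W : Type*} [AddCommGroup V] [Module ℝ V] [AddCommGroup W]
    [Module ℝ W] (α : V → W) (hadd : ∀ a b, α (a + b) = α a + α b)
    (hsmul : ∀ r : ℝ, 0 < r → ∀ a, α (r • a) = r • α a) : V →ₗ[ℝ] W where
  toFun := α
  map_add' := hadd
  map_smul' r a := by
    let β : V →+ W := AddMonoidHom.mk' α hadd
    rcases lt_trichotomy r 0 with hr | rfl | hr
    · have h : β (-r • a) = -r • β a := hsmul (-r) (neg_pos.2 hr) a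
      rw [neg_smul, map_neg, neg_smul, neg_inj] at h
      exact h
    · rw [zero_smul]
      exact (map_zero β).trans (zero_smul ℝ _).symm
    · exact hsmul r hr a

variable {L : QHeis n →* QHeis n}

theorem ver_map_mk_zero (hL : ∀ r : ℝ, 0 < r → ∀ h, L (dil r h) = dil r (L h)) (a : Hor n) :
    ver (L (mk a 0)) = 0 := by
  have h := congrArg ver (hL 2 two_pos (mk a 0))
  rw [dil_two_mk_zero, map_mul, ← mk_hor_ver (L (mk a 0)), mk_mul_mk, dil_mk, rho_self] at h
  have h_four : (2 : ℝ) • ver (L (mk a 0)) = (2 : ℝ) ^ 2 • ver (L (mk a 0)) := by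
    rw [two_smul]
    exact (add_zero _).symm.trans ((congrArg _ (smul_zero _).symm).trans h)
  rw [← sub_eq_zero, ← sub_smul] at h_four
  exact (smul_eq_zero.1 h_four).resolve_left (by norm_num)

theorem hor_map_zero_mk (hL : ∀ r : ℝ, 0 < r → ∀ h, L (dil r h) = dil r (L h)) (s : Ver) :
    hor (L (mk 0 s)) = 0 := by
  have h : (2 : ℝ) • hor (L (mk 0 s)) = √2 • hor (L (mk 0 s)) := by
    have h := congrArg hor (hL √2 (by positivity) (mk 0 s))
    rw [dil_sqrt_zero_mk two_pos.le, two_smul, ← zero_mk_mul_zero_mk, map_mul] at h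
    exact (two_smul ℝ _).trans h
  rw [← sub_eq_zero, ← sub_smul] at h
  refine (smul_eq_zero.1 h).resolve_left (sub_ne_zero.2 fun h2 => ?_)
  nlinarith [Real.sq_sqrt (two_pos (α := ℝ)).le]

theorem map_mk_zero (hL : ∀ r : ℝ, 0 < r → ∀ h, L (dil r h) = dil r (L h)) (a : Hor n) :
    L (mk a 0) = mk (hor (L (mk a 0))) 0 :=
  congrArg (mk _) (ver_map_mk_zero hL a)

theorem map_zero_mk (hL : ∀ r : ℝ, 0 < r → ∀ h, L (dil r h) = dil r (L h)) (s : Ver) :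
    L (mk 0 s) = mk 0 (ver (L (mk 0 s))) :=
  congrArg (mk · _) (hor_map_zero_mk hL s)

theorem map_mk (hL : ∀ r : ℝ, 0 < r → ∀ h, L (dil r h) = dil r (L h)) (a : Hor n) (s : Ver) :
    L (mk a s) = mk (hor (L (mk a 0))) (ver (L (mk 0 s))) := by
  rw [← mk_zero_mul_mk_zero a s, map_mul, map_mk_zero hL, map_zero_mk hL, mk_zero_mul_mk_zero]
  rfl

theorem exists_graded_of_dil_comm (hL : ∀ r : ℝ, 0 < r → ∀ h, L (dil r h) = dil r (L h)) :
    ∃ (A : Hor n →ₗ[ℝ] Hor n) (φ : Ver →ₗ[ℝ] Ver),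
      (∀ a s, L (mk a s) = mk (A a) (φ s)) ∧ ∀ v w, rho (A v) (A w) = φ (rho v w) := by
  have h_mul (a b : Hor n) : mk (hor (L (mk (a + b) 0))) (ver (L (mk 0 ((1 / 2 : ℝ) • rho a b)))) =
      mk (hor (L (mk a 0)) + hor (L (mk b 0)))
        ((1 / 2 : ℝ) • rho (hor (L (mk a 0))) (hor (L (mk b 0)))) := by
    have h := map_mul L (mk a 0) (mk b 0)
    rwa [map_mk_zero hL a, map_mk_zero hL b, mk_mul_mk, mk_mul_mk, add_zero, zero_add, zero_add,
      map_mk hL] at h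
  let A := linearOfPosHomogeneous (fun a => hor (L (mk a 0)))
    (fun a b => congrArg hor (h_mul a b)) fun r hr a => by
      rw [show mk (r • a) (0 : Ver) = dil r (mk a 0) by rw [dil_mk, smul_zero], hL r hr]
      rfl
  let φ := linearOfPosHomogeneous (fun s => ver (L (mk 0 s)))
    (fun s t => by
      rw [← zero_mk_mul_zero_mk, map_mul, map_zero_mk hL s, map_zero_mk hL t, zero_mk_mul_zero_mk]
      rfl)
    fun r hr s => by
      rw [← dil_sqrt_zero_mk hr.le, hL _ (Real.sqrt_pos.2 hr), map_zero_mk hL,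
        dil_sqrt_zero_mk hr.le]
      rfl
  refine ⟨A, φ, map_mk hL, fun v w => ?_⟩
  have h_half : φ ((1 / 2 : ℝ) • rho v w) = (1 / 2 : ℝ) • rho (A v) (A w) :=
    congrArg ver (h_mul v w)
  rw [map_smul] at h_half
  exact (smul_right_injective Ver (by norm_num : (1 / 2 : ℝ) ≠ 0) h_half).symm

theorem injective_of_rho_map {A : Hor n →ₗ[ℝ] Hor n} {φ : Ver → Ver} (hφ : ∀ c, φ c = 0 → c = 0)
    (hρ : ∀ v w, rho (A v) (A w) = φ (rho v w)) : Function.Injective A := by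
  refine (injective_iff_map_eq_zero A).2 fun v hv => eq_zero_of_rho_eq_zero (m := 0) fun w => ?_
  rw [hφ (rho v w) (by rw [← hρ, hv, rho_zero_left])]
  rfl

end GradedHomomorphisms

section LeftInvariantFields

variable {n : ℕ}

instance : FiniteDimensional ℝ (QHeis n) := inferInstanceAs (FiniteDimensional ℝ (Hor n × Ver))

instance : (volume : Measure (QHeis n)).IsAddHaarMeasure :=
  inferInstanceAs ((volume : Measure (Hor n)).prod (volume : Measure Ver)).IsAddHaarMeasure

/-- The projection `hor` to the horizontal coordinates, as a continuous linear map. -/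
def horL : QHeis n →L[ℝ] Hor n := ContinuousLinearMap.fst ℝ (Hor n) Ver

/-- The inclusion of the centre, as a continuous linear map. -/
def vertL : Ver →L[ℝ] QHeis n := ContinuousLinearMap.inr ℝ (Hor n) Ver

/-- The linear map `a ↦ ρ(a, w) / 2`, the central component of `leftField w` at a point over `a`. -/
def halfRho (w : Hor n) : Hor n →L[ℝ] Ver :=
  LinearMap.toContinuousLinearMap
    { toFun := fun a => (1 / 2 : ℝ) • rho a w
      map_add' := fun a b => by rw [rho_add_left, smul_add]
      map_smul' := fun r a => by rw [rho_smul_left, smul_comm]; rfl }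

theorem halfRho_apply (w a : Hor n) : halfRho w a = (1 / 2 : ℝ) • rho a w := rfl

theorem mk_eq_add (a : Hor n) (s : Ver) : mk a s = mk a 0 + vertL s :=
  Prod.ext (add_zero a).symm (zero_add s).symm

theorem hor_add_vertL (g : QHeis n) (c : Ver) : hor (g + vertL c) = hor g := add_zero (hor g)

theorem leftField_add_vertL (w : Hor n) (g : QHeis n) (c : Ver) :
    leftField w (g + vertL c) = leftField w g := by
  rw [leftField, leftField, hor_add_vertL]

theorem leftField_eq (w : Hor n) :
    leftField w = fun g : QHeis n => mk w 0 + vertL (halfRho w (horL g)) :=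
  funext fun _ => mk_eq_add _ _

theorem contDiff_leftField (w : Hor n) : ContDiff ℝ ∞ (leftField w : QHeis n → QHeis n) := by
  rw [leftField_eq]
  exact contDiff_const.add (vertL.comp ((halfRho w).comp horL)).contDiff

theorem hasFDerivAt_leftField (w : Hor n) (g : QHeis n) :
    HasFDerivAt (leftField w) (vertL.comp ((halfRho w).comp horL)) g := by
  rw [leftField_eq]
  exact (vertL.comp ((halfRho w).comp horL)).hasFDerivAt.const_add _

theorem fderiv_leftField_commutator {φ : QHeis n → ℝ} (hφ : ContDiff ℝ ∞ φ) (v w : Hor n)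
    (x : QHeis n) :
    fderiv ℝ (fun y => fderiv ℝ φ y (leftField w y)) x (leftField v x)
      - fderiv ℝ (fun y => fderiv ℝ φ y (leftField v y)) x (leftField w x)
      = fderiv ℝ φ x (vertL (rho v w)) := by
  have hD := ((hφ.fderiv_right (m := ∞) (by simp)).differentiable (by simp) x).hasFDerivAt
  have h_symm := second_derivative_symmetric
    (fun z => (hφ.differentiable (by simp) z).hasFDerivAt) hD (leftField v x) (leftField w x)
  have hX : ∀ w : Hor n, HasFDerivAt (fun y => fderiv ℝ φ y (leftField w y)) _ x := fun w =>
    hD.clm_apply (hasFDerivAt_leftField w x)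
  have h_hor : ∀ w : Hor n, horL (leftField w x) = w := fun _ => rfl
  rw [(hX w).fderiv, (hX v).fderiv]
  simp only [_root_.add_apply, ContinuousLinearMap.comp_apply, ContinuousLinearMap.flip_apply,
    h_hor, h_symm, halfRho_apply, rho_swap v w]
  rw [add_sub_add_right_eq_sub, ← map_sub, ← map_sub, smul_neg, sub_neg_eq_add, ← add_smul,
    add_halves, one_smul]

variable {W : Type*} [NormedAddCommGroup W] [NormedSpace ℝ W] {u a : QHeis n → W}

theorem HasWeakDerivAlong.vertL_zero [NeZero n] (hu : LocallyIntegrable u)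
    (h : ∀ w, HasWeakDerivAlong (leftField w) u fun _ => 0) (c : Ver) :
    HasWeakDerivAlong (fun _ => vertL c) u fun _ => 0 := by
  intro φ hφ hc
  obtain ⟨v, w, rfl⟩ := exists_rho_eq (n := n) c
  have h_smooth : ∀ w : Hor n, ContDiff ℝ ∞ fun y => fderiv ℝ φ y (leftField w y) := fun w =>
    (hφ.fderiv_right (m := ∞) (by simp)).clm_apply (contDiff_leftField w)
  have h_supp : ∀ w : Hor n, HasCompactSupport fun y => fderiv ℝ φ y (leftField w y) := fun w =>
    (hc.fderiv (𝕜 := ℝ)).mono fun x hx h0 => hx (by simp [h0])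
  have h_int : ∀ v w : Hor n, Integrable fun x =>
      fderiv ℝ (fun y => fderiv ℝ φ y (leftField w y)) x (leftField v x) • u x := fun v w =>
    integrable_fderiv_smul (h_smooth w) (h_supp w) (contDiff_leftField v).continuous hu
  simp only [← fderiv_leftField_commutator hφ v w, sub_smul]
  rw [integral_sub (h_int v w) (h_int w v), h v _ (h_smooth w) (h_supp w),
    h w _ (h_smooth v) (h_supp v)]
  simp only [smul_zero, sub_self, integral_zero, neg_zero]

theorem hasLineDerivAt_comp_hor (f : Hor n → W) (g : QHeis n) (c : Ver) :
    HasLineDerivAt ℝ (fun g => f (hor g)) 0 g (vertL c) := by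
  have h : ∀ t : ℝ, f (hor (g + t • vertL c)) = f (hor g) := fun t => by
    rw [← map_smul, hor_add_vertL]
  simpa only [HasLineDerivAt, h] using hasDerivAt_const (0 : ℝ) (f (hor g))

theorem HasWeakDerivAlong.vertL_comp_hor (hu : LocallyIntegrable u)
    (h : ∀ c, HasWeakDerivAlong (fun _ => vertL c) u fun _ => 0) {γ : Hor n → Ver}
    (hγ : ContDiff ℝ ∞ γ) : HasWeakDerivAlong (fun g => vertL (γ (hor g))) u fun _ => 0 := by
  let e := EuclideanSpace.basisFun (Fin 3) ℝ
  have h_smooth : ∀ k, ContDiff ℝ ∞ fun g : QHeis n => e.repr (γ (hor g)) k := fun k =>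
    (EuclideanSpace.proj (𝕜 := ℝ) k).contDiff.comp (hγ.comp (horL (n := n)).contDiff)
  have h_vert : ∀ k c (g : QHeis n), fderiv ℝ (fun g => e.repr (γ (hor g)) k) g (vertL c) = 0 :=
    fun k c g => (((h_smooth k).differentiable (by simp) g).hasFDerivAt.hasLineDerivAt _).unique
      (hasLineDerivAt_comp_hor (fun x => e.repr (γ x) k) g c)
  have h_sum : ∀ g : QHeis n, ∑ k, e.repr (γ (hor g)) k • vertL (e k) =
      (vertL (γ (hor g)) : QHeis n) := fun g => by
    simp only [← map_smul, ← map_sum, e.sum_repr]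
  have h_coord := HasWeakDerivAlong.sum_field (s := Finset.univ)
    (X := fun k g => e.repr (γ (hor g)) k • vertL (e k))
    (fun k => (h_smooth k).continuous.smul continuous_const) hu
    (fun _ => by simpa only [smul_zero] using locallyIntegrable_zero)
    fun k => (h (e k)).smul_field (h_smooth k) (h_vert k _)
  simpa only [h_sum, smul_zero, Finset.sum_const_zero] using h_coord

theorem HasWeakDerivAlong.const_of_leftField {ξ : QHeis n} (hu : LocallyIntegrable u)
    (ha : LocallyIntegrable a) (h : HasWeakDerivAlong (leftField (hor ξ)) u a)
    (h_vert : ∀ c, HasWeakDerivAlong (fun _ => vertL c) u fun _ => 0) :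
    HasWeakDerivAlong (fun _ => ξ) u a := by
  have hγ : ContDiff ℝ ∞ fun x => ver ξ - halfRho (hor ξ) x :=
    contDiff_const.sub (halfRho (hor ξ)).contDiff
  have h_field : ∀ g, leftField (hor ξ) g + vertL (ver ξ - halfRho (hor ξ) (hor g)) = ξ :=
    fun g => by
      rw [leftField_eq, add_assoc, ← map_add]
      exact (congrArg _ (congrArg _ (add_sub_cancel _ _))).trans (mk_eq_add _ _).symm
  have h_sum : HasWeakDerivAlong (fun g => leftField (hor ξ) g +
      vertL (ver ξ - halfRho (hor ξ) (hor g))) u fun g => a g + 0 :=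
    h.add_field (contDiff_leftField _).continuous
      (vertL.continuous.comp (hγ.continuous.comp (horL (n := n)).continuous)) hu ha
      locallyIntegrable_zero (.vertL_comp_hor hu h_vert hγ)
  simpa only [h_field, add_zero] using h_sum

theorem ae_eq_const_of_leftField_zero [NeZero n] [CompleteSpace W] (hu : LocallyIntegrable u)
    (h : ∀ w, HasWeakDerivAlong (leftField w) u fun _ => 0) : ∃ c, u =ᵐ[volume] fun _ => c :=
  ae_eq_const_of_hasWeakDerivAlong_zero hu fun ξ =>
    (h (hor ξ)).const_of_leftField hu locallyIntegrable_zero (.vertL_zero hu h)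

theorem hasWeakDerivAlong_vertL_comp_hor {f : Hor n → W} (hf : Continuous f) (c : Ver) :
    HasWeakDerivAlong (fun _ => vertL c) (fun g : QHeis n => f (hor g)) fun _ => 0 :=
  hasWeakDerivAlong_of_hasLineDerivAt (hf.comp (horL (n := n)).continuous).locallyIntegrable
    locallyIntegrable_zero fun g => hasLineDerivAt_comp_hor f g c

end LeftInvariantFields

section ContactLifts

variable {n : ℕ} {p : ℝ≥0∞} {f : Hor n → Hor n} {F : QHeis n → QHeis n}

theorem IsSobolevContact.exists_hasWeakDerivAlong_hor (hp : 1 ≤ p) (hF : IsSobolevContact p F)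
    (hlift : IsLift F f) (hf : Continuous f) (ξ : QHeis n) :
    ∃ a : QHeis n → Hor n, LocallyIntegrable a ∧
      HasWeakDerivAlong (fun _ => ξ) (fun g => f (hor g)) a := by
  obtain ⟨a, -, ha, -, hFa, -, -⟩ := hF.2.2 (hor ξ)
  have hal := ha.locallyIntegrable hp
  rw [show (fun g => hor (F g)) = fun g => f (hor g) from funext hlift] at hFa
  exact ⟨a, hal, hFa.const_of_leftField (hf.comp (horL (n := n)).continuous).locallyIntegrable hal
    (hasWeakDerivAlong_vertL_comp_hor hf)⟩

theorem IsSobolevContact.exists_vertical_increment [NeZero n] (hp : 1 ≤ p)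
    (hF : IsSobolevContact p F) (hlift : IsLift F f) (c : Ver) :
    ∃ d : Ver, ∀ᵐ g, ver (F (g + vertL c)) - ver (F g) = d := by
  obtain ⟨-, h_ver, hX⟩ := hF
  have hl := h_ver.locallyIntegrable hp
  have hlc := locallyIntegrable_comp_add_right hl (vertL c)
  refine ae_eq_const_of_leftField_zero (hlc.sub hl) fun w => ?_
  obtain ⟨a, b, ha, hb, hFa, hFb, hab⟩ := hX w
  have hal := ha.locallyIntegrable hp
  have hbl := hb.locallyIntegrable hp
  have h_field : ∀ g : QHeis n, leftField w (g + vertL c) = leftField w g :=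
    fun g => leftField_add_vertL w g c
  have h_hor : ∀ g, hor (F (g + vertL c)) = hor (F g) := fun g => by
    rw [hlift, hlift, hor_add_vertL]
  have hFa_shift := hFa.comp_add_right h_field
  simp only [h_hor] at hFa_shift
  have ha_inv := HasWeakDerivAlong.ae_eq hal (locallyIntegrable_comp_add_right hal _) hFa hFa_shift
  have hab_shift := (measurePreserving_add_right (volume : Measure (QHeis n))
    (vertL c)).quasiMeasurePreserving.ae hab
  have hb_inv : ∀ᵐ g, b (g + vertL c) - b g = 0 := by
    filter_upwards [ha_inv, hab, hab_shift] with g h_eq h h_shift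
    rw [show b g = _ from congrArg ver h, show b (g + vertL c) = _ from congrArg ver h_shift,
      ← h_eq]
    simp only [leftField, h_hor, sub_self]
  exact ((hFb.comp_add_right h_field).sub (contDiff_leftField w).continuous hlc
    (locallyIntegrable_comp_add_right hbl _) hl hbl hFb).congr_ae hb_inv

end ContactLifts

section PansuDifferential

theorem hasFDerivAt_of_tendstoUniformlyOn_sphere {E W : Type*} [NormedAddCommGroup E]
    [NormedSpace ℝ E] [NormedAddCommGroup W] [NormedSpace ℝ W] {f : E → W} {A : E →L[ℝ] W} {x : E}
    (h : TendstoUniformlyOn (fun (r : ℝ) w => r⁻¹ • (f (x + r • w) - f x)) A (𝓝[>] 0)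
      (Metric.sphere 0 1)) : HasFDerivAt f A x := by
  rw [hasFDerivAt_iff_isLittleO_nhds_zero, Asymptotics.isLittleO_iff]
  intro ε hε
  obtain ⟨δ, hδ, h_ball⟩ := Metric.mem_nhdsWithin_iff.1 (Metric.tendstoUniformlyOn_iff.1 h ε hε)
  filter_upwards [Metric.ball_mem_nhds 0 hδ] with v hv
  rcases eq_or_ne v 0 with rfl | hv0
  · simp
  have h_pos : 0 < ‖v‖ := norm_pos_iff.2 hv0
  have h_unit : ‖v‖⁻¹ • v ∈ Metric.sphere (0 : E) 1 := by
    simp [norm_smul, h_pos.ne']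
  have h_near := h_ball (a := ‖v‖) ⟨by simpa using hv, h_pos⟩ _ h_unit
  rw [smul_inv_smul₀ h_pos.ne', map_smul, dist_comm, dist_eq_norm, ← smul_sub, norm_smul, norm_inv,
    norm_norm, inv_mul_lt_iff₀ h_pos, mul_comm] at h_near
  exact h_near.le

variable {n : ℕ} {p : ℝ≥0∞} {f : Hor n → Hor n} {F : QHeis n → QHeis n} {L : QHeis n →* QHeis n}
  {g : QHeis n}

theorem mul_dil_zero_mk (g : QHeis n) (r : ℝ) (s : Ver) :
    g * dil r (mk 0 s) = g + vertL (r ^ 2 • s) := by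
  rw [dil_mk, smul_zero, ← mk_hor_ver g, mk_mul_mk, rho_zero_right, smul_zero]
  exact congrArg (mk _) (add_zero _)

theorem HasPansuDerivAt.hasFDerivAt (h : HasPansuDerivAt F L g) (hlift : IsLift F f)
    {A : Hor n →L[ℝ] Hor n} (hA : ∀ w, hor (L (mk w 0)) = A w) : HasFDerivAt f A (hor g) := by
  have h_mk : Continuous fun w : Hor n => mk w (0 : Ver) := continuous_id.prodMk continuous_const
  have h_unif := (horL.uniformContinuous.comp_tendstoUniformlyOn
    (h.2 _ ((isCompact_sphere 0 1).image h_mk))).comp fun w => mk w (0 : Ver)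
  refine hasFDerivAt_of_tendstoUniformlyOn_sphere
    (((h_unif.mono (Set.subset_preimage_image _ _)).congr (.of_forall fun r w _ => ?_)).congr_right
      fun w _ => hA w)
  change r⁻¹ • (-hor (F g) + hor (F (g * dil r (mk w 0)))) = _
  rw [hlift, hlift, neg_add_eq_sub]
  rfl

theorem HasPansuDerivAt.tendsto_ver (h : HasPansuDerivAt F L g) (hlift : IsLift F f) (s : Ver) :
    Tendsto (fun r : ℝ => r⁻¹ ^ 2 • (ver (F (g + vertL (r ^ 2 • s))) - ver (F g))) (𝓝[>] 0)
      (𝓝 (ver (L (mk 0 s)))) := by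
  have h_lim := (h.2 {mk 0 s} isCompact_singleton).tendsto_at (Set.mem_singleton _)
  refine ((continuous_snd.tendsto _).comp h_lim).congr fun r => ?_
  change r⁻¹ ^ 2 • (-ver (F g) + ver (F (g * dil r (mk 0 s)))
    + (1 / 2 : ℝ) • rho (-hor (F g)) (hor (F (g * dil r (mk 0 s))))) = _
  rw [mul_dil_zero_mk, hlift (g + _), hor_add_vertL, ← hlift g, rho_neg_self, smul_zero, add_zero,
    neg_add_eq_sub]

theorem HasPansuDerivAt.exists_hasFDerivAt (h : HasPansuDerivAt F L g) (hlift : IsLift F f) :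
    ∃ A : Hor n →L[ℝ] Hor n, HasFDerivAt f A (hor g) ∧
      ∀ v w, rho (A v) (A w) = ver (L (mk 0 (rho v w))) := by
  obtain ⟨A, φ, hL, hρ⟩ := exists_graded_of_dil_comm h.1
  refine ⟨A.toContinuousLinearMap, h.hasFDerivAt hlift fun w => ?_, fun v w => ?_⟩
  · rw [hL]
    rfl
  · rw [hL]
    exact hρ v w

theorem IsSobolevContact.exists_tendsto_ver [NeZero n] (hp : 1 ≤ p) (hF : IsSobolevContact p F)
    (hlift : IsLift F f) (s : Ver) :
    ∃ d : ℕ → Ver, ∀ᵐ g, ∀ L : QHeis n →* QHeis n, HasPansuDerivAt F L g →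
      Tendsto d atTop (𝓝 (ver (L (mk 0 s)))) := by
  set r : ℕ → ℝ := fun k => 1 / ((k : ℝ) + 1)
  have hr : Tendsto r atTop (𝓝[>] 0) :=
    tendsto_nhdsWithin_iff.2 ⟨tendsto_one_div_add_atTop_nhds_zero_nat,
      Eventually.of_forall fun _ => Set.mem_Ioi.2 Nat.one_div_pos_of_nat⟩
  choose d hd using fun k => hF.exists_vertical_increment hp hlift (r k ^ 2 • s)
  refine ⟨fun k => (r k)⁻¹ ^ 2 • d k, ?_⟩
  filter_upwards [ae_all_iff.2 hd] with g hg L hL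
  refine ((hL.tendsto_ver hlift s).comp hr).congr fun k => ?_
  simp only [Function.comp_apply, hg]

theorem IsSobolevContact.exists_ver_pansuDeriv_eq [NeZero n] (hp : 1 ≤ p)
    (hF : IsSobolevContact p F) (hlift : IsLift F f) :
    ∃ φ : Ver →ₗ[ℝ] Ver, ∀ᵐ g, ∀ L : QHeis n →* QHeis n, HasPansuDerivAt F L g →
      ∀ s, ver (L (mk 0 s)) = φ s := by
  let e := (EuclideanSpace.basisFun (Fin 3) ℝ).toBasis
  choose d hd using fun k => hF.exists_tendsto_ver hp hlift (e k)
  have hd_all := ae_all_iff.2 hd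
  by_cases h_pt : ∃ g₀ L₀, HasPansuDerivAt F L₀ g₀ ∧
      ∀ k, Tendsto (d k) atTop (𝓝 (ver (L₀ (mk 0 (e k)))))
  · obtain ⟨g₀, L₀, h₀, hd₀⟩ := h_pt
    obtain ⟨_, φ, hφ, -⟩ := exists_graded_of_dil_comm h₀.1
    refine ⟨φ, ?_⟩
    filter_upwards [hd_all] with g hg L hL s
    obtain ⟨_, ψ, hψ, -⟩ := exists_graded_of_dil_comm hL.1
    have h_eq : ψ = φ := e.ext fun k => by
      have h_lim := tendsto_nhds_unique (hg k L hL) (hd₀ k)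
      rw [hψ, hφ] at h_lim
      exact h_lim
    rw [hψ, h_eq]
    rfl
  · refine ⟨0, ?_⟩
    filter_upwards [hd_all] with g hg L hL
    exact absurd ⟨g, L, hL, fun k => hg k L hL⟩ h_pt

theorem IsSobolevContact.exists_scaling [NeZero n] (hp : 1 ≤ p) (hF : IsSobolevContact p F)
    (hlift : IsLift F f) (hdiff : ∀ᵐ g, ∃ L : QHeis n →* QHeis n, HasPansuDerivAt F L g)
    (hrank : ∃ᶠ g in ae volume, ∃ L : QHeis n →* QHeis n,
      HasPansuDerivAt F L g ∧ Function.Injective L) :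
    ∃ φ : Ver ≃L[ℝ] Ver, ∀ᵐ g : QHeis n, ∃ A : Hor n ≃L[ℝ] Hor n,
      HasFDerivAt f (A : Hor n →L[ℝ] Hor n) (hor g) ∧ ∀ v w, rho (A v) (A w) = φ (rho v w) := by
  obtain ⟨φ, hφ⟩ := hF.exists_ver_pansuDeriv_eq hp hlift
  obtain ⟨g₀, ⟨L₀, h₀, h_inj⟩, hφ₀⟩ := (hrank.and_eventually hφ).exists
  have hφ_inj : Function.Injective φ := fun s t hst => by
    refine congrArg ver (@h_inj (mk 0 s) (mk 0 t) ?_)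
    rw [map_zero_mk h₀.1, map_zero_mk h₀.1 t, hφ₀ L₀ h₀, hφ₀ L₀ h₀, hst]
  refine ⟨(LinearEquiv.ofInjectiveEndo φ hφ_inj).toContinuousLinearEquiv, ?_⟩
  filter_upwards [hdiff, hφ] with g ⟨L, hL⟩ hφg
  obtain ⟨A, hA, hρ⟩ := hL.exists_hasFDerivAt hlift
  simp only [hφg L hL] at hρ
  have hA_inj := injective_of_rho_map (A := A.toLinearMap)
    (fun c => (map_eq_zero_iff φ hφ_inj).1) hρ
  exact ⟨(LinearEquiv.ofInjectiveEndo _ hA_inj).toContinuousLinearEquiv, hA, hρ⟩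

end PansuDifferential

section Rigidity

variable {n : ℕ} {f : Hor n → Hor n} {φ : Ver ≃L[ℝ] Ver}

theorem map_quatUnit_of_rho_scaling {A A₀ : Hor n ≃L[ℝ] Hor n}
    (hA : ∀ v w, rho (A v) (A w) = φ (rho v w)) (hA₀ : ∀ v w, rho (A₀ v) (A₀ w) = φ (rho v w))
    (m : Fin 3) (v : Hor n) : A (quatUnit m v) = A₀ (quatUnit m (A₀.symm (A v))) := by
  have h_symm : ∀ a b, rho (A₀.symm a) (A₀.symm b) = φ.symm (rho a b) := fun a b => by
    rw [ContinuousLinearEquiv.eq_symm_apply, ← hA₀, A₀.apply_symm_apply, A₀.apply_symm_apply]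
  rw [← map_quatUnit_of_rho_eq (B := fun a => A₀.symm (A a)) (A₀.symm.surjective.comp A.surjective)
    (fun a b => by rw [h_symm, hA, φ.symm_apply_apply]), A₀.apply_symm_apply]

theorem eq_affine_of_ae_scaling (hf : Continuous f)
    (h_weak : ∀ ξ : QHeis n, ∃ a : QHeis n → Hor n, LocallyIntegrable a ∧
      HasWeakDerivAlong (fun _ => ξ) (fun g => f (hor g)) a)
    (h_scale : ∀ᵐ g : QHeis n, ∃ A : Hor n ≃L[ℝ] Hor n,
      HasFDerivAt f (A : Hor n →L[ℝ] Hor n) (hor g) ∧ ∀ v w, rho (A v) (A w) = φ (rho v w)) :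
    ∃ (A : Hor n ≃L[ℝ] Hor n) (b : Hor n),
      (∀ x, f x = A x + b) ∧ ∀ v w, rho (A v) (A w) = φ (rho v w) := by
  obtain ⟨g₀, A₀, hA₀, hρ₀⟩ := h_scale.exists
  choose a ha h_deriv using h_weak
  have hu : Continuous fun g : QHeis n => f (hor g) := hf.comp (horL (n := n)).continuous
  let P (m : Fin 3) : Hor n →L[ℝ] Hor n :=
    (A₀ : Hor n →L[ℝ] Hor n) ∘L (quatUnit m).toContinuousLinearMap ∘L A₀.symm
  have hP : ∀ m y, P m y = A₀ (quatUnit m (A₀.symm y)) := fun _ _ => rfl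
  have h_intertwine : ∀ m ξ, a (mk (quatUnit m (hor ξ)) 0) =ᵐ[volume] fun g => P m (a ξ g) := by
    intro m ξ
    filter_upwards [h_scale, (h_deriv ξ).ae_eq_of_hasFDerivAt hu.locallyIntegrable (ha _),
      (h_deriv (mk (quatUnit m (hor ξ)) 0)).ae_eq_of_hasFDerivAt hu.locallyIntegrable (ha _)]
      with g ⟨A, hA, hρ⟩ hξ hKξ
    have hAg := hA.comp g (horL (n := n)).hasFDerivAt
    rw [hξ _ hAg, hKξ _ hAg]
    exact map_quatUnit_of_rho_scaling hρ hρ₀ m (hor ξ)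
  obtain ⟨T, b, hT⟩ := exists_ae_eq_affine_of_intertwining (P₁ := P 0) (P₂ := P 1)
    hu.locallyIntegrable ha h_deriv (fun y hy => by
      simp only [hP, A₀.symm_apply_apply, A₀.injective.eq_iff] at hy
      exact A₀.symm.map_eq_zero_iff.1 (eq_zero_of_quatUnit_comm hy))
    (h_intertwine 0) (h_intertwine 1)
  have h_eq := (hu.ae_eq_iff_eq volume (by fun_prop)).1 hT
  have hTA : T = (A₀ : Hor n →L[ℝ] Hor n) ∘L horL :=
    ((T.hasFDerivAt (x := g₀)).add_const b).unique (h_eq ▸ hA₀.comp g₀ (horL (n := n)).hasFDerivAt)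
  refine ⟨A₀, b, fun x => ?_, hρ₀⟩
  exact (congrFun h_eq (mk x 0)).trans (by rw [hTA]; rfl)

end Rigidity

end QuatHeis

end

theorem theorem5p2_general (n : ℕ) (p : ℝ≥0∞) (hp : 1 ≤ p)
    (f : QuatHeis.Hor n → QuatHeis.Hor n) (hf : Continuous f)
    (F : QuatHeis.QHeis n → QuatHeis.QHeis n) (hF : QuatHeis.IsSobolevContact p F)
    (hlift : QuatHeis.IsLift F f)
    (hdiff : ∀ᵐ g : QuatHeis.QHeis n, ∃ L : QuatHeis.QHeis n →* QuatHeis.QHeis n,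
      QuatHeis.HasPansuDerivAt F L g)
    (hrank : ∃ᶠ g in ae volume, ∃ L : QuatHeis.QHeis n →* QuatHeis.QHeis n,
      QuatHeis.HasPansuDerivAt F L g ∧ Function.Injective L) :
    ∃ (A : QuatHeis.Hor n ≃L[ℝ] QuatHeis.Hor n) (b : QuatHeis.Hor n)
      (φ : QuatHeis.Ver ≃L[ℝ] QuatHeis.Ver),
      (∀ x, f x = A x + b) ∧
      (∀ v w, QuatHeis.rho (A v) (A w) = φ (QuatHeis.rho v w)) ∧
      ∀ x q, ∃ U : QuatHeis.Hor n ≃ₗᵢ[ℝ] QuatHeis.Hor n,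
        (∀ v, fderiv ℝ f x v = U (fderiv ℝ f q v)) ∧
        ∀ v w, QuatHeis.rho (U v) (U w) = QuatHeis.rho v w := by
  open QuatHeis in
  suffices h : ∃ (A : Hor n ≃L[ℝ] Hor n) (b : Hor n) (φ : Ver ≃L[ℝ] Ver),
      (∀ x, f x = A x + b) ∧ ∀ v w, rho (A v) (A w) = φ (rho v w) by
    obtain ⟨A, b, φ, hfA, hρ⟩ := h
    have h_fderiv : ∀ x, fderiv ℝ f x = A := fun x => by
      rw [funext hfA, fderiv_add_const]
      exact A.fderiv
    exact ⟨A, b, φ, hfA, hρ, fun x q => ⟨.refl ℝ _,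
      fun v => by rw [h_fderiv, h_fderiv]; rfl, fun _ _ => rfl⟩⟩
  rcases eq_zero_or_neZero n with rfl | hn
  · exact ⟨.refl ℝ _, 0, .refl ℝ _, fun x => Subsingleton.elim _ _, fun v w => rfl⟩
  obtain ⟨φ, hφ⟩ := hF.exists_scaling hp hlift hdiff hrank
  obtain ⟨A, b, h_affine, hρ⟩ :=
    eq_affine_of_ae_scaling hf (hF.exists_hasWeakDerivAlong_hor hp hlift hf) hφ
  exact ⟨A, b, φ, h_affine, hρ⟩

theorem theorem5p2 (n : ℕ) (p : ℝ≥0∞) (hp : 1 ≤ p)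
    (f : QuatHeis.Hor n → QuatHeis.Hor n) (hf : Continuous f) (hfS : QuatHeis.IsSobolev p f)
    (F : QuatHeis.QHeis n → QuatHeis.QHeis n) (hF : QuatHeis.IsSobolevContact p F)
    (hlift : QuatHeis.IsLift F f)
    (hrank : ∀ᵐ g : QuatHeis.QHeis n, ∃ L : QuatHeis.QHeis n →* QuatHeis.QHeis n,
      QuatHeis.HasPansuDerivAt F L g ∧ Function.Bijective L) :
    ∃ (A : QuatHeis.Hor n ≃L[ℝ] QuatHeis.Hor n) (b : QuatHeis.Hor n)
      (φ : QuatHeis.Ver ≃L[ℝ] QuatHeis.Ver),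
      (∀ x, f x = A x + b) ∧
      (∀ v w, QuatHeis.rho (A v) (A w) = φ (QuatHeis.rho v w)) ∧
      ∀ x q, ∃ U : QuatHeis.Hor n ≃ₗᵢ[ℝ] QuatHeis.Hor n,
        (∀ v, fderiv ℝ f x v = U (fderiv ℝ f q v)) ∧
        ∀ v w, QuatHeis.rho (U v) (U w) = QuatHeis.rho v w :=
  theorem5p2_general n p hp f hf F hF hlift (hrank.mono fun _ ⟨L, hL, _⟩ => ⟨L, hL⟩)
    (hrank.mono fun _ ⟨L, hL, h⟩ => ⟨L, hL, h.injective⟩).frequently
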